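/- Let $\mathcal C$ be an exact Goursat category: a finitely complete regular category in which every internal equivalence relation is effective (i.e. is the kernel pair of some morphism), and in which $R\circ S\circ R=S\circ R\circ S$ for any two equivalence relations $R,S$ on the same object. A Birkhoff subcategory $\mathcal L$ of $\mathcal C$ is a full replete reflective subcategory such that every component $\eta_X$ of the unit of the reflection is a regular epimorphism, and such that, for every regular epimorphism $f\colon X\to Y$ with $X$ in $\mathcal L$, also $Y$ is in $\mathcal L$. The associated closure operator sends an equivalence relation $S$ on $X$, with canonical quotient $q\colon X\to X/S$ (the coequaliser of the two projections of $S$), to the kernel pair $\overline S$ of $\eta_{X/S}\circ q$. For a regular epimorphism $f\colon X\to Y$ and an equivalence relation $S$ on $X$, $f(S)$ denotes the regular image of $S$ along $f$, i.e. the image of $S\to X\times X\xrightarrow{f\times f} Y\times Y$; it is an equivalence relation on $Y$ by the Goursat property. **Proposition.** For an exact Goursat category $\mathcal C$ the following conditions are equivalent: 1. for every object $X$ of $\mathcal C$, the equivalence relations on $X$, ordered by inclusion, form a distributive lattice; 2. for every Birkhoff subcategory $\mathcal L$ of $\mathcal C$, the associated closure operator satisfies $$f(\overline{R\wedge S})=\overline{f(R)}\wedge\overline{f(S)}$$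 for every regular epimorphism $f\colon X\to Y$ and all equivalence relations $R,S$ on $X$. -/

import Mathlib

open CategoryTheory CategoryTheory.Limits

universe v u

namespace GoursatCat

theorem factors_mk_iff {C : Type u} [Category.{v} C] {A B T : C} (m : A ⟶ B) [Mono m]
    (b : T ⟶ B) : (Subobject.mk m).Factors b ↔ ∃ t : T ⟶ A, t ≫ m = b :=
  Subobject.mk_factors_iff m b

theorem factors_iff {C : Type u} [Category.{v} C] {B T : C} (P : Subobject B) (b : T ⟶ B) :
    P.Factors b ↔ ∃ t : T ⟶ (P : C), t ≫ P.arrow = b := by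
  rw [← factors_mk_iff P.arrow b, Subobject.mk_arrow]

section Relations

variable {C : Type u} [Category.{v} C] [Regular C]

/-- The generalised elements `a, b : T ⟶ X` are related by the relation `R` on `X`. -/
def Rel {X : C} (R : Subobject (X ⨯ X)) {T : C} (a b : T ⟶ X) : Prop :=
  R.Factors (prod.lift a b)

/-- A relation `R` on `X`, that is, a subobject of `X ⨯ X`, is an (internal) equivalence relation
when its two projections to `X` form an internal equivalence relation. -/
def IsEqRel {X : C} (R : Subobject (X ⨯ X)) : Prop :=
  IsEquivalenceRelation (R.arrow ≫ prod.fst) (R.arrow ≫ prod.snd)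

theorem rel_iff {X : C} {R : Subobject (X ⨯ X)} {T : C} {a b : T ⟶ X} :
    Rel R a b ↔ ∃ t : T ⟶ (R : C), t ≫ R.arrow ≫ prod.fst = a ∧ t ≫ R.arrow ≫ prod.snd = b := by
  rw [Rel, factors_iff]
  refine exists_congr fun t => ⟨fun h => ?_, fun h => ?_⟩
  · rw [← Category.assoc, h, ← Category.assoc, h, prod.lift_fst, prod.lift_snd]
    exact ⟨rfl, rfl⟩
  · refine Limits.prod.hom_ext ?_ ?_
    · rw [prod.lift_fst, Category.assoc, h.1]
    · rw [prod.lift_snd, Category.assoc, h.2]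

theorem Rel.precomp {X : C} {R : Subobject (X ⨯ X)} {T T' : C} {a b : T ⟶ X} (h : Rel R a b)
    (e : T' ⟶ T) : Rel R (e ≫ a) (e ≫ b) := by
  obtain ⟨t, rfl, rfl⟩ := rel_iff.1 h
  exact rel_iff.2 ⟨e ≫ t, by simp, by simp⟩

/-- An internal equivalence relation is one that is reflexive, symmetric and transitive on
generalised elements. -/
theorem isEqRel_iff {X : C} {R : Subobject (X ⨯ X)} :
    IsEqRel R ↔ (∀ {T : C} (a : T ⟶ X), Rel R a a) ∧
      (∀ {T : C} {a b : T ⟶ X}, Rel R a b → Rel R b a) ∧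
      (∀ {T : C} {a b c : T ⟶ X}, Rel R a b → Rel R b c → Rel R a c) := by
  constructor
  · rintro ⟨⟨E⟩⟩
    refine ⟨fun a => rel_iff.2 ⟨a ≫ E.r, ?_, ?_⟩, fun h => ?_, fun h h' => ?_⟩
    · rw [Category.assoc, E.reflexivity₁, Category.comp_id]
    · rw [Category.assoc, E.reflexivity₂, Category.comp_id]
    · obtain ⟨t, rfl, rfl⟩ := rel_iff.1 h
      refine rel_iff.2 ⟨t ≫ E.s, ?_, ?_⟩
      · rw [Category.assoc, E.symmetry₁]
      · rw [Category.assoc, E.symmetry₂]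
    · obtain ⟨t, rfl, rfl⟩ := rel_iff.1 h
      obtain ⟨t', h₁, rfl⟩ := rel_iff.1 h'
      let l := PullbackCone.IsLimit.lift E.isLimit t t' h₁.symm
      refine rel_iff.2 ⟨l ≫ E.t, ?_, ?_⟩
      · rw [Category.assoc, E.transitivity₁, ← Category.assoc, PullbackCone.IsLimit.lift_fst]
      · rw [Category.assoc, E.transitivity₂, ← Category.assoc, PullbackCone.IsLimit.lift_snd]
  · rintro ⟨hr, hs, ht⟩
    obtain ⟨r, hr₁, hr₂⟩ := rel_iff.1 (hr (𝟙 X))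
    obtain ⟨s, hs₁, hs₂⟩ := rel_iff.1 (hs (rel_iff.2 ⟨𝟙 (R : C), rfl, rfl⟩))
    have key := pullback.condition (f := R.arrow ≫ prod.snd) (g := R.arrow ≫ prod.fst)
    obtain ⟨t, ht₁, ht₂⟩ := rel_iff.1 (ht
      (rel_iff.2 ⟨pullback.fst (R.arrow ≫ prod.snd) (R.arrow ≫ prod.fst), rfl, rfl⟩)
      (rel_iff.2 ⟨pullback.snd (R.arrow ≫ prod.snd) (R.arrow ≫ prod.fst), key.symm, rfl⟩))
    exact ⟨⟨{
      right_cancellation := fun Y f g h₁ h₂ => by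
        rw [← cancel_mono R.arrow]
        ext
        · simpa using h₁
        · simpa using h₂
      r := r
      reflexivity₁ := hr₁
      reflexivity₂ := hr₂
      s := s
      symmetry₁ := by simpa using hs₁
      symmetry₂ := by simpa using hs₂
      c := pullback.cone _ _
      isLimit := pullback.isLimit _ _
      t := t
      transitivity₁ := ht₁
      transitivity₂ := ht₂ }⟩⟩

/-- A generalised element belongs to the image of `g` exactly when it lifts along `g` after
passing to a cover. -/
theorem image_factors_iff {A B T : C} (g : A ⟶ B) (b : T ⟶ B) :
    (Subobject.mk (image.ι g)).Factors b ↔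
      ∃ (T' : C) (e : T' ⟶ T) (_ : IsRegularEpi e) (a : T' ⟶ A), a ≫ g = e ≫ b := by
  rw [factors_mk_iff]
  constructor
  · rintro ⟨t, ht⟩
    have : IsRegularEpi (factorThruImage g) := inferInstance
    refine ⟨pullback t (factorThruImage g), pullback.fst _ _, inferInstance, pullback.snd _ _, ?_⟩
    rw [← ht, pullback.condition_assoc, image.fac]
  · rintro ⟨T', e, he, a, h⟩
    have sq : CommSq (a ≫ factorThruImage g) e (image.ι g) b := ⟨by simpa using h⟩
    exact ⟨sq.lift, sq.fac_right⟩

theorem isRegularEpi_comp {X Y Z : C} (f : X ⟶ Y) (g : Y ⟶ Z) [IsRegularEpi f]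
    [IsRegularEpi g] : IsRegularEpi (f ≫ g) := by
  have : StrongEpi (f ≫ g) := strongEpi_comp f g
  infer_instance

/-- The composite of two relations: `(a, b)` is in it when there is, locally, some `z` with
`(a, z)` in `R` and `(z, b)` in `S`. It is the image in `X ⨯ X` of the pullback `R ×_X S`. -/
noncomputable def comp {X : C} (R S : Subobject (X ⨯ X)) : Subobject (X ⨯ X) :=
  Subobject.mk (image.ι (prod.lift
    (pullback.fst (R.arrow ≫ prod.snd) (S.arrow ≫ prod.fst) ≫ R.arrow ≫ prod.fst)
    (pullback.snd (R.arrow ≫ prod.snd) (S.arrow ≫ prod.fst) ≫ S.arrow ≫ prod.snd)))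

theorem rel_comp_iff {X : C} {R S : Subobject (X ⨯ X)} {T : C} {a b : T ⟶ X} :
    Rel (comp R S) a b ↔ ∃ (T' : C) (e : T' ⟶ T) (_ : IsRegularEpi e) (z : T' ⟶ X),
      Rel R (e ≫ a) z ∧ Rel S z (e ≫ b) := by
  unfold Rel comp
  rw [image_factors_iff]
  constructor
  · rintro ⟨T', e, he, p, hp⟩
    have h₁ := congrArg (· ≫ prod.fst) hp
    have h₂ := congrArg (· ≫ prod.snd) hp
    simp only [Category.assoc, prod.lift_fst, prod.lift_snd] at h₁ h₂
    refine ⟨T', e, he, p ≫ pullback.fst _ _ ≫ R.arrow ≫ prod.snd,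
      rel_iff.2 ⟨p ≫ pullback.fst _ _, by simpa using h₁, by simp⟩,
      rel_iff.2 ⟨p ≫ pullback.snd _ _, by simp [pullback.condition], by simpa using h₂⟩⟩
  · rintro ⟨T', e, he, z, h₁, h₂⟩
    obtain ⟨t, ht, ht'⟩ := rel_iff.1 h₁
    obtain ⟨s, hs, hs'⟩ := rel_iff.1 h₂
    refine ⟨T', e, he, pullback.lift t s (ht'.trans hs.symm), ?_⟩
    refine Limits.prod.hom_ext ?_ ?_
    · simpa only [Category.assoc, prod.lift_fst, pullback.lift_fst_assoc] using ht
    · simpa only [Category.assoc, prod.lift_snd, pullback.lift_snd_assoc] using hs'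

/-- The kernel pair `R[g]` of `g`, as a relation. -/
noncomputable def kernelRel {X Y : C} (g : X ⟶ Y) : Subobject (X ⨯ X) :=
  equalizerSubobject (prod.fst ≫ g) (prod.snd ≫ g)

theorem rel_kernelRel_iff {X Y : C} {g : X ⟶ Y} {T : C} {a b : T ⟶ X} :
    Rel (kernelRel g) a b ↔ a ≫ g = b ≫ g := by
  unfold Rel kernelRel
  rw [equalizerSubobject_factors_iff, ← Category.assoc, ← Category.assoc, prod.lift_fst,
    prod.lift_snd]

theorem isEqRel_kernelRel {X Y : C} (g : X ⟶ Y) : IsEqRel (kernelRel g) := by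
  rw [isEqRel_iff]
  simp only [rel_kernelRel_iff]
  exact ⟨fun _ => trivial, fun h => h.symm, fun h h' => h.trans h'⟩

/-- The regular image `f(R)`: the image of the composite `R ⟶ X ⨯ X ⟶ Y ⨯ Y`. -/
noncomputable def imageRel {X Y : C} (f : X ⟶ Y) (R : Subobject (X ⨯ X)) : Subobject (Y ⨯ Y) :=
  Subobject.mk (image.ι (R.arrow ≫ prod.map f f))

theorem rel_imageRel_iff {X Y : C} {f : X ⟶ Y} {R : Subobject (X ⨯ X)} {T : C} {a b : T ⟶ Y} :
    Rel (imageRel f R) a b ↔ ∃ (T' : C) (e : T' ⟶ T) (_ : IsRegularEpi e) (x y : T' ⟶ X),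
      Rel R x y ∧ x ≫ f = e ≫ a ∧ y ≫ f = e ≫ b := by
  unfold imageRel
  rw [Rel, image_factors_iff]
  constructor
  · rintro ⟨T', e, he, p, hp⟩
    have h₁ := congrArg (· ≫ prod.fst) hp
    have h₂ := congrArg (· ≫ prod.snd) hp
    simp only [Category.assoc, prod.lift_fst, prod.lift_snd, prod.map_fst, prod.map_snd] at h₁ h₂
    exact ⟨T', e, he, p ≫ R.arrow ≫ prod.fst, p ≫ R.arrow ≫ prod.snd,
      rel_iff.2 ⟨p, rfl, rfl⟩, by simpa using h₁, by simpa using h₂⟩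
  · rintro ⟨T', e, he, x, y, h, h₁, h₂⟩
    obtain ⟨t, rfl, rfl⟩ := rel_iff.1 h
    refine ⟨T', e, he, t, ?_⟩
    refine Limits.prod.hom_ext ?_ ?_
    · simpa only [Category.assoc, prod.lift_fst, prod.map_fst] using h₁
    · simpa only [Category.assoc, prod.lift_snd, prod.map_snd] using h₂

theorem isEqRel_inf {X : C} {R S : Subobject (X ⨯ X)} (hR : IsEqRel R) (hS : IsEqRel S) :
    IsEqRel (R ⊓ S) := by
  rw [isEqRel_iff] at *
  simp only [Rel, Subobject.inf_factors] at *
  exact ⟨fun a => ⟨hR.1 a, hS.1 a⟩, fun h => ⟨hR.2.1 h.1, hS.2.1 h.2⟩,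
    fun h h' => ⟨hR.2.2 h.1 h'.1, hS.2.2 h.2 h'.2⟩⟩

end Relations

/-- A regular category is (Barr) exact when every internal equivalence relation is effective, that
is, is the kernel pair of some morphism. -/
class IsExact (C : Type u) [Category.{v} C] [Regular C] : Prop where
  effective {X R : C} (p₁ p₂ : R ⟶ X) (h : IsEquivalenceRelation p₁ p₂) :
    ∃ (Y : C) (g : X ⟶ Y), IsKernelPair g p₁ p₂

/-- The Goursat property: `R ∘ S ∘ R = S ∘ R ∘ S` for all equivalence relations `R`, `S` on the
same object. -/
class IsGoursat (C : Type u) [Category.{v} C] [Regular C] : Prop where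
  three_permutable {X : C} (R S : Subobject (X ⨯ X)) (hR : IsEqRel R) (hS : IsEqRel S) :
    comp (comp R S) R = comp (comp S R) S

/-- The equivalence relations on `X`, as subobjects of `X ⨯ X`. -/
@[ext]
structure EqRel {C : Type u} [Category.{v} C] [Regular C] (X : C) : Type (max u v) where
  /-- The underlying relation. -/
  rel : Subobject (X ⨯ X)
  isEqRel : IsEqRel rel

section Operations

variable {C : Type u} [Category.{v} C] [Regular C]

/-- Equivalence relations are ordered by inclusion of subobjects; binary meets are intersections of
subobjects. -/
noncomputable instance (X : C) : SemilatticeInf (EqRel X) where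
  le R S := R.rel ≤ S.rel
  le_refl R := le_refl R.rel
  le_trans _ _ _ h h' := le_trans (α := Subobject (X ⨯ X)) h h'
  le_antisymm _ _ h h' := EqRel.ext (le_antisymm h h')
  inf R S := ⟨R.rel ⊓ S.rel, isEqRel_inf R.isEqRel S.isEqRel⟩
  inf_le_left R S := _root_.inf_le_left (a := R.rel) (b := S.rel)
  inf_le_right R S := _root_.inf_le_right (a := R.rel) (b := S.rel)
  le_inf _ _ _ h h' := _root_.le_inf (α := Subobject (X ⨯ X)) h h'

/-- The kernel pair of a morphism as an equivalence relation. -/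
noncomputable def kernelPair {X Y : C} (g : X ⟶ Y) : EqRel X :=
  ⟨kernelRel g, isEqRel_kernelRel g⟩

/-- In a regular Goursat category, regular images of equivalence relations along regular
epimorphisms are equivalence relations. -/
theorem isEqRel_imageRel [IsGoursat C] {X Y : C} (f : X ⟶ Y) [IsRegularEpi f]
    {R : Subobject (X ⨯ X)} (hR : IsEqRel R) : IsEqRel (imageRel f R) := by
  have hR' := isEqRel_iff.1 hR
  refine isEqRel_iff.2 ⟨fun {T} a => ?_, fun {T a b} h => ?_, fun {T a b c} h h' => ?_⟩
  · exact rel_imageRel_iff.2 ⟨pullback a f, pullback.fst a f, inferInstance, pullback.snd a f,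
      pullback.snd a f, hR'.1 _, pullback.condition.symm, pullback.condition.symm⟩
  · obtain ⟨T', e, he, x, y, hxy, hx, hy⟩ := rel_imageRel_iff.1 h
    exact rel_imageRel_iff.2 ⟨T', e, he, y, x, hR'.2.1 hxy, hy, hx⟩
  · obtain ⟨T₁, e₁, he₁, x, y, hxy, hx, hy⟩ := rel_imageRel_iff.1 h
    obtain ⟨T₂, e₂, he₂, z, w, hzw, hz, hw⟩ := rel_imageRel_iff.1 h'
    let P := pullback e₁ e₂
    let p₁ : P ⟶ T₁ := pullback.fst e₁ e₂
    let p₂ : P ⟶ T₂ := pullback.snd e₁ e₂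
    have hP : p₁ ≫ e₁ = p₂ ≫ e₂ := pullback.condition
    have : IsRegularEpi p₁ := inferInstanceAs (IsRegularEpi (pullback.fst e₁ e₂))
    have hK : Rel (kernelRel f) (p₁ ≫ y) (p₂ ≫ z) := rel_kernelRel_iff.2 (by
      rw [Category.assoc, Category.assoc, hy, hz, reassoc_of% hP])
    have hc : Rel (comp (comp R (kernelRel f)) R) (p₁ ≫ x) (p₂ ≫ w) := by
      refine rel_comp_iff.2 ⟨P, 𝟙 P, inferInstance, p₂ ≫ z, rel_comp_iff.2
        ⟨P, 𝟙 P, inferInstance, p₁ ≫ y, ?_, ?_⟩, ?_⟩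
      · simpa using hxy.precomp p₁
      · simpa using hK
      · simpa using hzw.precomp p₂
    rw [IsGoursat.three_permutable R (kernelRel f) hR (isEqRel_kernelRel f)] at hc
    obtain ⟨T₃, e₃, he₃, s, h₃, h₃'⟩ := rel_comp_iff.1 hc
    obtain ⟨T₄, e₄, he₄, t, h₄, h₄'⟩ := rel_comp_iff.1 h₃
    rw [rel_kernelRel_iff] at h₃' h₄
    have i₁ : IsRegularEpi (p₁ ≫ e₁) := isRegularEpi_comp _ _
    have i₂ : IsRegularEpi (e₃ ≫ p₁ ≫ e₁) := isRegularEpi_comp _ _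
    have i₃ : IsRegularEpi (e₄ ≫ e₃ ≫ p₁ ≫ e₁) := isRegularEpi_comp _ _
    refine rel_imageRel_iff.2 ⟨T₄, e₄ ≫ e₃ ≫ p₁ ≫ e₁, i₃, t, e₄ ≫ s, h₄', ?_, ?_⟩
    · rw [← h₄]
      simp only [Category.assoc, hx]
    · rw [Category.assoc, h₃']
      simp only [Category.assoc, hw, reassoc_of% hP]

/-- The regular image `f(R)` of an equivalence relation along a regular epimorphism, in a Goursat
category. -/
noncomputable def regularImage [IsGoursat C] {X Y : C} (f : X ⟶ Y) [IsRegularEpi f]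
    (R : EqRel X) : EqRel Y :=
  ⟨imageRel f R.rel, isEqRel_imageRel f R.isEqRel⟩

/-- In an exact category the two projections of an equivalence relation have a coequaliser. -/
instance [IsExact C] {X : C} (R : EqRel X) :
    HasCoequalizer (R.rel.arrow ≫ prod.fst) (R.rel.arrow ≫ prod.snd) := by
  obtain ⟨Y, g, h⟩ := IsExact.effective _ _ R.isEqRel
  exact Regular.hasCoequalizer_of_isKernelPair h

/-- The quotient object `X / R`. -/
noncomputable abbrev quotient [IsExact C] {X : C} (R : EqRel X) : C :=
  coequalizer (R.rel.arrow ≫ prod.fst) (R.rel.arrow ≫ prod.snd)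

/-- The canonical quotient map `X ⟶ X / R`, the coequaliser of the two projections of `R`. -/
noncomputable abbrev quotientMap [IsExact C] {X : C} (R : EqRel X) : X ⟶ quotient R :=
  coequalizer.π (R.rel.arrow ≫ prod.fst) (R.rel.arrow ≫ prod.snd)

end Operations

/-- A Birkhoff subcategory: a full replete reflective subcategory such that every component of the
unit of the reflection is a regular epimorphism, and which is closed under regular quotients. -/
structure BirkhoffSubcategory (C : Type u) [Category.{v} C] where
  /-- The class of objects of the full subcategory. -/
  obj : ObjectProperty C
  replete : obj.IsClosedUnderIsomorphisms
  /-- The reflector, together with the adjunction. -/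
  reflective : Reflective obj.ι
  isRegularEpi_unit (X : C) : IsRegularEpi ((reflectorAdjunction obj.ι).unit.app X)
  of_isRegularEpi {X Y : C} (f : X ⟶ Y) (hf : IsRegularEpi f) (hX : obj X) : obj Y

/-- The unit `η_X` of the reflection into a Birkhoff subcategory. -/
noncomputable def BirkhoffSubcategory.unit {C : Type u} [Category.{v} C]
    (L : BirkhoffSubcategory C) (X : C) :
    letI := L.reflective
    X ⟶ L.obj.ι.obj ((reflector L.obj.ι).obj X) :=
  letI := L.reflective
  (reflectorAdjunction L.obj.ι).unit.app X

/-- The closure of an equivalence relation `S` on `X` associated with a Birkhoff subcategory: the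
kernel pair of the composite of `X ⟶ X / S` with the unit `η_{X / S}` of the reflection. -/
noncomputable def BirkhoffSubcategory.closure {C : Type u} [Category.{v} C] [Regular C] [IsExact C]
    (L : BirkhoffSubcategory C) {X : C} (S : EqRel X) : EqRel X :=
  kernelPair (quotientMap S ≫ L.unit (quotient S))

/-- The partially ordered set of equivalence relations on every object is a distributive
lattice. -/
def CongruenceDistributive (C : Type u) [Category.{v} C] [Regular C] : Prop :=
  ∀ X : C, ∃ D : DistribLattice (EqRel X), ∀ R S : EqRel X, D.le R S ↔ R ≤ S

end GoursatCat

open GoursatCat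

/-! Both conditions say that joining with a fixed equivalence relation preserves binary meets. For a
regular epimorphism `f`, the saturation `f⁻¹(f(R))` is the join `Ker f ∨ R`
(`isLUB_preimage_regularImage`). By exactness every `T` is the kernel pair of its quotient map, so
all joins arise this way; since inverse images preserve meets and are injective along `f`,
distributivity amounts to regular images preserving meets.

Closures are joins too: `S` closes to `Ker η_X ∨ S` (`isLUB_closure`), because the Birkhoff property
gives `f(Ker η_X) = Ker η_Y`. Images preserve joins, so they commute with closure, and
distributivity yields the formula. Conversely, taking the whole category as the Birkhoff subcategory
makes closure the identity, and the formula becomes preservation of meets. -/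

namespace GoursatCat

/-! ### Inverse images and kernel pairs via generalised elements -/

section Calculus

variable {C : Type u} [Category.{v} C] [Regular C]

/-- Being related can be tested after passing to a cover. -/
theorem Rel.of_precomp {X : C} {R : Subobject (X ⨯ X)} {T T' : C} {a b : T ⟶ X} (e : T' ⟶ T)
    [IsRegularEpi e] (h : Rel R (e ≫ a) (e ≫ b)) : Rel R a b := by
  rw [Rel, ← prod.comp_lift] at h
  obtain ⟨t, ht⟩ := (factors_iff R _).1 h
  -- A regular epimorphism is strong, so the square against the mono `R.arrow` has a diagonal.
  have sq : CommSq t e R.arrow (prod.lift a b) := ⟨ht⟩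
  exact (factors_iff R _).2 ⟨sq.lift, sq.fac_right⟩

theorem EqRel.le_iff {X : C} {R S : EqRel X} :
    R ≤ S ↔ ∀ {T : C} (a b : T ⟶ X), Rel R.rel a b → Rel S.rel a b := by
  constructor
  · intro h T a b hab
    exact Subobject.factors_of_le _ h hab
  · intro h
    have hR : Rel S.rel (R.rel.arrow ≫ prod.fst) (R.rel.arrow ≫ prod.snd) :=
      h _ _ (rel_iff.2 ⟨𝟙 _, by simp, by simp⟩)
    obtain ⟨t, h₁, h₂⟩ := rel_iff.1 hR
    exact Subobject.le_of_comm t (by ext <;> simpa)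

theorem EqRel.ext_rel {X : C} {R S : EqRel X}
    (h : ∀ {T : C} (a b : T ⟶ X), Rel R.rel a b ↔ Rel S.rel a b) : R = S :=
  le_antisymm (EqRel.le_iff.2 fun a b => (h a b).1) (EqRel.le_iff.2 fun a b => (h a b).2)

theorem rel_inf_iff {X : C} {R S : EqRel X} {T : C} {a b : T ⟶ X} :
    Rel (R ⊓ S).rel a b ↔ Rel R.rel a b ∧ Rel S.rel a b :=
  Subobject.inf_factors _

theorem rel_pullback_iff {X Y : C} {f : X ⟶ Y} {R : Subobject (Y ⨯ Y)} {T : C} {a b : T ⟶ X} :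
    Rel ((Subobject.pullback (prod.map f f)).obj R) a b ↔ Rel R (a ≫ f) (b ≫ f) := by
  have h := Subobject.isPullback (prod.map f f) R
  rw [Rel, Rel, factors_iff, factors_iff, ← prod.lift_map]
  constructor
  · rintro ⟨t, ht⟩
    exact ⟨t ≫ Subobject.pullbackπ _ _, by rw [Category.assoc, h.w, reassoc_of% ht]⟩
  · rintro ⟨t, ht⟩
    exact ⟨h.lift t _ ht, h.lift_snd _ _ _⟩

/-- The inverse image of an equivalence relation along a morphism. -/
noncomputable def preimage {X Y : C} (f : X ⟶ Y) (R : EqRel Y) : EqRel X where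
  rel := (Subobject.pullback (prod.map f f)).obj R.rel
  isEqRel := by
    have hR := isEqRel_iff.1 R.isEqRel
    rw [isEqRel_iff]
    simp only [rel_pullback_iff]
    exact ⟨fun _ => hR.1 _, fun h => hR.2.1 h, fun h h' => hR.2.2 h h'⟩

theorem rel_preimage_iff {X Y : C} {f : X ⟶ Y} {R : EqRel Y} {T : C} {a b : T ⟶ X} :
    Rel (preimage f R).rel a b ↔ Rel R.rel (a ≫ f) (b ≫ f) :=
  rel_pullback_iff

theorem preimage_inf {X Y : C} (f : X ⟶ Y) (R S : EqRel Y) :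
    preimage f (R ⊓ S) = preimage f R ⊓ preimage f S :=
  EqRel.ext_rel fun a b => by simp only [rel_preimage_iff, rel_inf_iff]

theorem preimage_kernelPair {X Y Z : C} (f : X ⟶ Y) (g : Y ⟶ Z) :
    preimage f (kernelPair g) = kernelPair (f ≫ g) :=
  EqRel.ext_rel fun a b => by
    rw [rel_preimage_iff, kernelPair, kernelPair, rel_kernelRel_iff, rel_kernelRel_iff,
      Category.assoc, Category.assoc]

theorem kernelPair_le_preimage {X Y : C} (f : X ⟶ Y) (R : EqRel Y) :
    kernelPair f ≤ preimage f R :=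
  EqRel.le_iff.2 fun a b h => by
    rw [rel_preimage_iff, rel_kernelRel_iff.1 h]
    exact (isEqRel_iff.1 R.isEqRel).1 _

/-- A regular epimorphism is the universal morphism with its kernel pair. -/
theorem exists_fac_of_kernelPair_le {X Y Z : C} (f : X ⟶ Y) [IsRegularEpi f] (g : X ⟶ Z)
    (h : kernelPair f ≤ kernelPair g) : ∃ k : Y ⟶ Z, f ≫ k = g :=
  ⟨IsRegularEpi.desc f g (rel_kernelRel_iff.1
    (EqRel.le_iff.1 h _ _ (rel_kernelRel_iff.2 (IsRegularEpi.w f)))), IsRegularEpi.fac f g _⟩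

theorem kernelPair_le_kernelPair_of_fac {X Y Z : C} {f : X ⟶ Y} {g : X ⟶ Z} (k : Y ⟶ Z)
    (h : f ≫ k = g) : kernelPair f ≤ kernelPair g := by
  rw [← h, ← preimage_kernelPair]
  exact kernelPair_le_preimage _ _

theorem kernelPair_comp_mono {X Y Z : C} (f : X ⟶ Y) (g : Y ⟶ Z) [Mono g] :
    kernelPair (f ≫ g) = kernelPair f :=
  EqRel.ext_rel fun a b => by
    rw [kernelPair, kernelPair, rel_kernelRel_iff, rel_kernelRel_iff, ← Category.assoc,
      ← Category.assoc, cancel_mono]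

/-- In an exact category every equivalence relation is the kernel pair of its quotient. -/
theorem kernelPair_quotientMap [IsExact C] {X : C} (R : EqRel X) :
    kernelPair (quotientMap R) = R := by
  obtain ⟨Y, g, hg⟩ := IsExact.effective _ _ R.isEqRel
  apply le_antisymm
  -- The effective `g` factors through the quotient map, whose kernel pair thus lies in that of `g`,
  -- namely `R`.
  · refine (kernelPair_le_kernelPair_of_fac (g := g) (coequalizer.desc g hg.w)
      (coequalizer.π_desc _ _)).trans ?_
    refine EqRel.le_iff.2 fun a b h => rel_iff.2 ?_
    exact ⟨hg.lift a b (rel_kernelRel_iff.1 h), hg.lift_fst _ _ _, hg.lift_snd _ _ _⟩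
  · refine EqRel.le_iff.2 fun a b h => rel_kernelRel_iff.2 ?_
    obtain ⟨t, rfl, rfl⟩ := rel_iff.1 h
    have := coequalizer.condition (R.rel.arrow ≫ prod.fst) (R.rel.arrow ≫ prod.snd)
    rw [Category.assoc, this, ← Category.assoc]

/-! ### Regular images, saturations and joins -/

section Goursat

variable [IsGoursat C]

theorem gc_regularImage_preimage {X Y : C} (f : X ⟶ Y) [IsRegularEpi f] :
    GaloisConnection (regularImage f) (preimage f) := by
  intro R S
  constructor
  · intro h
    refine EqRel.le_iff.2 fun a b hab => rel_preimage_iff.2 (EqRel.le_iff.1 h _ _ ?_)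
    exact rel_imageRel_iff.2 ⟨_, 𝟙 _, inferInstance, a, b, hab, by simp, by simp⟩
  · intro h
    refine EqRel.le_iff.2 fun a b hab => ?_
    obtain ⟨T, e, he, x, y, hxy, hx, hy⟩ := rel_imageRel_iff.1 hab
    refine Rel.of_precomp e ?_
    rw [← hx, ← hy]
    exact rel_preimage_iff.1 (EqRel.le_iff.1 h _ _ hxy)

/-- Along a regular epimorphism any pair in `S` lifts to `X` after passing to a cover: one pullback
lifts `a`, a second lifts `b`. -/
theorem regularImage_preimage {X Y : C} (f : X ⟶ Y) [IsRegularEpi f] (S : EqRel Y) :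
    regularImage f (preimage f S) = S := by
  refine le_antisymm ((gc_regularImage_preimage f).l_u_le S) (EqRel.le_iff.2 fun {T} a b h => ?_)
  let p : pullback a f ⟶ T := pullback.fst a f
  have hp : p ≫ a = pullback.snd a f ≫ f := pullback.condition
  have hq : pullback.fst (p ≫ b) f ≫ p ≫ b = pullback.snd (p ≫ b) f ≫ f := pullback.condition
  have : IsRegularEpi p := inferInstanceAs (IsRegularEpi (pullback.fst a f))
  have he : IsRegularEpi (pullback.fst (p ≫ b) f ≫ p) := isRegularEpi_comp _ _
  refine rel_imageRel_iff.2 ⟨_, _, he, pullback.fst (p ≫ b) f ≫ pullback.snd a f,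
    pullback.snd (p ≫ b) f, rel_preimage_iff.2 ?_, ?_, ?_⟩
  · rw [Category.assoc, ← hp, ← hq, ← Category.assoc, ← Category.assoc]
    exact h.precomp _
  · rw [Category.assoc, Category.assoc, hp]
  · rw [Category.assoc, hq]

theorem preimage_injective {X Y : C} (f : X ⟶ Y) [IsRegularEpi f] :
    Function.Injective (preimage f) :=
  Function.LeftInverse.injective (regularImage_preimage f)

/-- The saturation of `R` along `f` is the join of `R` with the kernel pair of `f`. -/
theorem isLUB_preimage_regularImage {X Y : C} (f : X ⟶ Y) [IsRegularEpi f] (R : EqRel X) :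
    IsLUB {kernelPair f, R} (preimage f (regularImage f R)) := by
  constructor
  · rintro _ (rfl | rfl)
    · exact kernelPair_le_preimage _ _
    · exact (gc_regularImage_preimage f).le_u_l _
  · intro U hU
    have hK : kernelPair f ≤ U := hU (by simp)
    have hR : R ≤ U := hU (by simp)
    refine EqRel.le_iff.2 fun a b hab => ?_
    obtain ⟨T, e, he, x, y, hxy, hx, hy⟩ := rel_imageRel_iff.1 (rel_preimage_iff.1 hab)
    have hU' := isEqRel_iff.1 U.isEqRel
    have h₁ : Rel U.rel (e ≫ a) x :=
      EqRel.le_iff.1 hK _ _ (rel_kernelRel_iff.2 (by rw [Category.assoc, hx]))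
    have h₂ : Rel U.rel y (e ≫ b) :=
      EqRel.le_iff.1 hK _ _ (rel_kernelRel_iff.2 (by rw [Category.assoc, hy]))
    -- On a cover the pair is joined by a chain in `Ker f`, `R`, `Ker f`, all contained in the
    -- transitive `U`.
    exact Rel.of_precomp e (hU'.2.2 (hU'.2.2 h₁ (EqRel.le_iff.1 hR _ _ hxy)) h₂)

theorem isLUB_regularImage {X Y : C} (f : X ⟶ Y) [IsRegularEpi f] {R S J : EqRel X}
    (h : IsLUB {R, S} J) : IsLUB {regularImage f R, regularImage f S} (regularImage f J) := by
  rw [← Set.image_pair]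
  exact (gc_regularImage_preimage f).isLUB_l_image h

/-- If regular images preserve binary meets, the equivalence relations on every object form a
distributive lattice. -/
theorem congruenceDistributive_of_regularImage_inf [IsExact C]
    (h : ∀ {X Y : C} (f : X ⟶ Y) [IsRegularEpi f] (R S : EqRel X),
      regularImage f (R ⊓ S) = regularImage f R ⊓ regularImage f S) :
    CongruenceDistributive C := by
  intro X
  have hlub : ∀ T R : EqRel X, IsLUB {T, R}
      (preimage (quotientMap T) (regularImage (quotientMap T) R)) := fun T R => by
    simpa only [kernelPair_quotientMap] using isLUB_preimage_regularImage (quotientMap T) R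
  exact ⟨{
    (inferInstance : SemilatticeInf (EqRel X)) with
    sup := fun T R => preimage (quotientMap T) (regularImage (quotientMap T) R)
    le_sup_left := fun T R => (hlub T R).1 (by simp)
    le_sup_right := fun T R => (hlub T R).1 (by simp)
    sup_le := fun T R U hT hR => (hlub T R).2 (by rintro _ (rfl | rfl) <;> assumption)
    le_sup_inf := fun T R S => by
      refine le_of_eq ?_
      change preimage _ _ ⊓ preimage _ _ = preimage (quotientMap T) (regularImage _ (R ⊓ S))
      rw [h, preimage_inf] }, fun R S => Iff.rfl⟩

end Goursat

end Calculus

/-- Distributivity of a meet semilattice underlying a distributive lattice, for joins given as least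
upper bounds. -/
theorem isLUB_inf_eq {α : Type*} [i : SemilatticeInf α]
    (h : ∃ D : DistribLattice α, ∀ a b : α, D.le a b ↔ a ≤ b) {t r s j₁ j₂ j : α}
    (h₁ : IsLUB {t, r} j₁) (h₂ : IsLUB {t, s} j₂) (hj : IsLUB {t, r ⊓ s} j) : j = j₁ ⊓ j₂ := by
  obtain ⟨D, hD⟩ := h
  -- The order determines meets, so those of `D` are the given ones.
  obtain rfl : D.toLattice.toSemilatticeInf = i := SemilatticeInf.ext hD
  rw [h₁.unique isLUB_pair, h₂.unique isLUB_pair, hj.unique isLUB_pair, sup_inf_left]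

/-! ### Birkhoff subcategories and their closure operators -/

section Birkhoff

variable {C : Type u} [Category.{v} C]

/-- The whole category as a Birkhoff subcategory of itself. -/
noncomputable def BirkhoffSubcategory.top (C : Type u) [Category.{v} C] :
    BirkhoffSubcategory C :=
  haveI : (⊤ : ObjectProperty C).ι.EssSurj := ⟨fun X => ⟨⟨X, trivial⟩, ⟨Iso.refl _⟩⟩⟩
  haveI : (⊤ : ObjectProperty C).ι.IsEquivalence := {}
  { obj := ⊤
    replete := ⟨fun _ _ => trivial⟩
    reflective :=
      { L := (⊤ : ObjectProperty C).ι.inv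
        adj := (⊤ : ObjectProperty C).ι.asEquivalence.symm.toAdjunction }
    isRegularEpi_unit := fun X => by
      have : IsIso ((⊤ : ObjectProperty C).ι.asEquivalence.symm.toAdjunction.unit.app X) :=
        inferInstanceAs (IsIso ((⊤ : ObjectProperty C).ι.asEquivalence.symm.unitIso.hom.app X))
      exact inferInstanceAs (IsRegularEpi
        ((⊤ : ObjectProperty C).ι.asEquivalence.symm.toAdjunction.unit.app X))
    of_isRegularEpi := fun _ _ _ => trivial }

theorem BirkhoffSubcategory.isIso_unit (L : BirkhoffSubcategory C) {X : C} (hX : L.obj X) :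
    IsIso (L.unit X) :=
  letI := L.reflective
  Functor.essImage.unit_isIso (i := L.obj.ι) ⟨⟨X, hX⟩, ⟨Iso.refl _⟩⟩

instance (L : BirkhoffSubcategory C) (X : C) : IsRegularEpi (L.unit X) :=
  L.isRegularEpi_unit X

/-- Morphisms into objects of the subcategory factor through the unit. -/
theorem BirkhoffSubcategory.exists_unit_fac (L : BirkhoffSubcategory C) {X Z : C} (hZ : L.obj Z)
    (g : X ⟶ Z) : ∃ k, L.unit X ≫ k = g := by
  let _ := L.reflective
  have := L.isIso_unit hZ
  have hn : g ≫ L.unit Z = L.unit X ≫ L.obj.ι.map ((reflector L.obj.ι).map g) :=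
    (reflectorAdjunction L.obj.ι).unit.naturality g
  exact ⟨L.obj.ι.map ((reflector L.obj.ι).map g) ≫ inv (L.unit Z), by
    rw [← Category.assoc, ← hn, Category.assoc, IsIso.hom_inv_id, Category.comp_id]⟩

theorem BirkhoffSubcategory.obj_reflector (L : BirkhoffSubcategory C) (X : C) :
    letI := L.reflective
    L.obj (L.obj.ι.obj ((reflector L.obj.ι).obj X)) :=
  letI := L.reflective
  ((reflector L.obj.ι).obj X).property

variable [Regular C] [IsExact C]

theorem BirkhoffSubcategory.closure_top {X : C} (S : EqRel X) :
    (BirkhoffSubcategory.top C).closure S = S := by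
  have : IsIso ((BirkhoffSubcategory.top C).unit (quotient S)) :=
    (BirkhoffSubcategory.top C).isIso_unit trivial
  rw [BirkhoffSubcategory.closure, kernelPair_comp_mono, kernelPair_quotientMap]

variable [IsGoursat C] (L : BirkhoffSubcategory C)

/-- The kernel pairs of the units are preserved by regular images. -/
theorem BirkhoffSubcategory.regularImage_kernelPair_unit {X Y : C} (f : X ⟶ Y) [IsRegularEpi f] :
    regularImage f (kernelPair (L.unit X)) = kernelPair (L.unit Y) := by
  apply le_antisymm
  -- By adjunction the claim is `Ker η_X ≤ Ker (f ≫ η_Y)`, and `f ≫ η_Y` has its target in `L`.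
  · rw [gc_regularImage_preimage f, preimage_kernelPair]
    obtain ⟨k, hk⟩ := L.exists_unit_fac (L.obj_reflector Y) (f ≫ L.unit Y)
    exact kernelPair_le_kernelPair_of_fac k hk
  -- The map `f ≫ q` factors through `η_X`, which exhibits the target of `q` as a regular quotient
  -- of an object of `L`. It therefore lies in `L`, and `q` factors through `η_Y`.
  · let q := quotientMap (regularImage f (kernelPair (L.unit X)))
    have hq : kernelPair q = regularImage f (kernelPair (L.unit X)) := kernelPair_quotientMap _
    have hle : kernelPair (L.unit X) ≤ kernelPair (f ≫ q) := by
      rw [← preimage_kernelPair, hq]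
      exact (gc_regularImage_preimage f).le_u_l _
    obtain ⟨k, hk⟩ := exists_fac_of_kernelPair_le _ _ hle
    have : IsRegularEpi (L.unit X ≫ k) := hk ▸ isRegularEpi_comp f q
    have : StrongEpi k := strongEpi_of_strongEpi (L.unit X) k
    have hQ := L.of_isRegularEpi k inferInstance (L.obj_reflector X)
    obtain ⟨l, hl⟩ := L.exists_unit_fac hQ q
    rw [← hq]
    exact kernelPair_le_kernelPair_of_fac l hl

/-- The closure of `S` is the join of `S` with the kernel pair of the unit. -/
theorem BirkhoffSubcategory.isLUB_closure {X : C} (S : EqRel X) :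
    IsLUB {kernelPair (L.unit X), S} (L.closure S) := by
  -- With `q` the quotient map of `S`, the closure is `q⁻¹(Ker η_{X/S}) = q⁻¹(q(Ker η_X))`, a
  -- saturation.
  rw [BirkhoffSubcategory.closure, ← preimage_kernelPair,
    ← L.regularImage_kernelPair_unit (quotientMap S), Set.pair_comm]
  simpa only [kernelPair_quotientMap] using
    isLUB_preimage_regularImage (quotientMap S) (kernelPair (L.unit X))

/-- Both sides are the join of `Ker η_Y` and `f(S)`. -/
theorem BirkhoffSubcategory.regularImage_closure {X Y : C} (f : X ⟶ Y) [IsRegularEpi f]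
    (S : EqRel X) : regularImage f (L.closure S) = L.closure (regularImage f S) := by
  have h := isLUB_regularImage f (L.isLUB_closure S)
  rw [L.regularImage_kernelPair_unit] at h
  exact h.unique (L.isLUB_closure _)

end Birkhoff

/-! ### Consequences of distributivity -/

/-- After applying the injective `f⁻¹`, this is distributivity of joining with `Ker f`. -/
theorem CongruenceDistributive.regularImage_inf {C : Type u} [Category.{v} C] [Regular C]
    [IsGoursat C] (h : CongruenceDistributive C) {X Y : C} (f : X ⟶ Y)
    [IsRegularEpi f] (R S : EqRel X) :
    regularImage f (R ⊓ S) = regularImage f R ⊓ regularImage f S := by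
  apply preimage_injective f
  rw [preimage_inf]
  exact isLUB_inf_eq (h X) (isLUB_preimage_regularImage f R) (isLUB_preimage_regularImage f S)
    (isLUB_preimage_regularImage f (R ⊓ S))

theorem CongruenceDistributive.closure_inf {C : Type u} [Category.{v} C] [Regular C] [IsExact C]
    [IsGoursat C] (h : CongruenceDistributive C) (L : BirkhoffSubcategory C) {X : C}
    (R S : EqRel X) : L.closure (R ⊓ S) = L.closure R ⊓ L.closure S :=
  isLUB_inf_eq (h X) (L.isLUB_closure R) (L.isLUB_closure S) (L.isLUB_closure (R ⊓ S))

end GoursatCat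

open GoursatCat
theorem mainTheorem6 (C : Type u) [Category.{v} C] [Regular C] [IsExact C] [IsGoursat C] :
    CongruenceDistributive C ↔
      ∀ (L : BirkhoffSubcategory C) {X Y : C} (f : X ⟶ Y) [IsRegularEpi f] (R S : EqRel X),
        regularImage f (L.closure (R ⊓ S)) =
          L.closure (regularImage f R) ⊓ L.closure (regularImage f S) := by
  constructor
  · intro h L X Y f _ R S
    rw [h.closure_inf, h.regularImage_inf, L.regularImage_closure, L.regularImage_closure]
  · intro h
    refine congruenceDistributive_of_regularImage_inf fun f _ R S => ?_
    simpa only [BirkhoffSubcategory.closure_top] using h (BirkhoffSubcategory.top C) f R S
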